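/- For an integer $n\ge 1$ and a real $\beta\ge 0$ let $$Z_{n,\beta}:=\int_{\mathbb{R}^n}\exp\Big(-\frac12\sum_{i=1}^n\lambda_i^2\Big)\prod_{1\le i<j\le n}|\lambda_j-\lambda_i|^{\beta}\,\mathrm{d}\lambda_1\cdots\mathrm{d}\lambda_n$$ be the partition function of the Gaussian $\beta$-ensemble. For real sequences $u=(u_n)$, $v=(v_n)$ write $u\ll v$ (equivalently $v\gg u$) if $u_n/v_n\to 0$ as $n\to\infty$. Let $\beta=(\beta_n)$ and $\beta'=(\beta'_n)$ be real sequences with $\beta_n\ge 0$ and $\beta'_n>0$ for all $n$. 1. If $\beta\ll\beta'\ll \frac1{n^2}$, then $\dfrac{Z_{n,\beta'_n}}{Z_{n,\beta_n}}\to 1$ as $n\to\infty$. 2. If $\beta\ll\beta'\ll\frac1n$ and $\beta'\gg\frac1{n^2}$, then $Z_{n,\beta'_n}\ll Z_{n,\beta_n}$. -/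

import Mathlib

open Filter Topology MeasureTheory

/-- The unnormalized density of the Gaussian `β`-ensemble on `ℝⁿ`:
`exp (-(1/2) ∑ᵢ λᵢ²) * ∏_{i < j} |λⱼ - λᵢ| ^ β`. -/
noncomputable def gaussianBetaWeight (n : ℕ) (β : ℝ) (x : Fin n → ℝ) : ℝ :=
  Real.exp (-(1 / 2) * ∑ i, x i ^ 2) * ∏ i : Fin n, ∏ j ∈ Finset.Ioi i, |x j - x i| ^ β

/-- The partition function `Z_{n,β}`: the integral of the weight over `ℝⁿ` with respect to
Lebesgue measure. -/
noncomputable def partitionFunction (n : ℕ) (β : ℝ) : ℝ :=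
  ∫ x : Fin n → ℝ, gaussianBetaWeight n β x

/-- `u ≪ v`: the ratio `u n / v n` tends to `0` as `n → ∞`. -/
def MuchLess (u v : ℕ → ℝ) : Prop :=
  Tendsto (fun n => u n / v n) atTop (𝓝 0)

theorem gaussianBetaWeight_nonneg (n : ℕ) (β : ℝ) (x : Fin n → ℝ) :
    0 ≤ gaussianBetaWeight n β x := by
  unfold gaussianBetaWeight
  exact mul_nonneg (Real.exp_pos _).le (Finset.prod_nonneg fun i _ =>
    Finset.prod_nonneg fun j _ => Real.rpow_nonneg (abs_nonneg _) _)

theorem continuous_gaussianBetaWeight (n : ℕ) {β : ℝ} (hβ : 0 ≤ β) :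
    Continuous (gaussianBetaWeight n β) := by
  unfold gaussianBetaWeight
  refine Continuous.mul (by fun_prop) ?_
  refine continuous_finsetProd _ fun i _ => continuous_finsetProd _ fun j _ => ?_
  exact Continuous.rpow_const (by fun_prop) fun _ => Or.inr hβ

/-- The integral defining `Z_{n,β}` converges for every `β ≥ 0`. -/
theorem integrable_gaussianBetaWeight (n : ℕ) {β : ℝ} (hβ : 0 ≤ β) :
    Integrable (gaussianBetaWeight n β) := by
  set C : ℝ := 2 * β * ∑ i : Fin n, ((Finset.Ioi i).card : ℝ) with hC
  have h1 : Integrable (fun t : ℝ => Real.exp (C ^ 2) * Real.exp (-(1 / 4) * t ^ 2)) :=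
    (integrable_exp_neg_mul_sq (by norm_num)).const_mul _
  have h2 : Integrable (fun x : Fin n → ℝ =>
      ∏ i, (Real.exp (C ^ 2) * Real.exp (-(1 / 4) * x i ^ 2))) :=
    Integrable.fintype_prod (fun _ => h1)
  refine h2.mono' (continuous_gaussianBetaWeight n hβ).aestronglyMeasurable
    (Eventually.of_forall fun x => ?_)
  rw [Real.norm_of_nonneg (gaussianBetaWeight_nonneg n β x)]
  have h3 : ∀ i j : Fin n, |x j - x i| ^ β ≤ Real.exp (2 * β * ∑ k, |x k|) := by
    intro i j
    have hk : ∀ k, |x k| ≤ ∑ k, |x k| := fun k =>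
      Finset.single_le_sum (f := fun k => |x k|) (fun _ _ => abs_nonneg _) (Finset.mem_univ k)
    have ha : |x j - x i| ≤ Real.exp (2 * ∑ k, |x k|) := by
      have := abs_sub (x j) (x i)
      have := Real.add_one_le_exp (2 * ∑ k, |x k|)
      linarith [hk i, hk j]
    calc |x j - x i| ^ β ≤ Real.exp (2 * ∑ k, |x k|) ^ β :=
          Real.rpow_le_rpow (abs_nonneg _) ha hβ
      _ = Real.exp (2 * β * ∑ k, |x k|) := by
          rw [← Real.exp_mul]; ring_nf
  have h4 : ∏ i : Fin n, ∏ j ∈ Finset.Ioi i, |x j - x i| ^ β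
      ≤ Real.exp (C * ∑ k, |x k|) := by
    calc ∏ i : Fin n, ∏ j ∈ Finset.Ioi i, |x j - x i| ^ β
        ≤ ∏ i : Fin n, ∏ _j ∈ Finset.Ioi i, Real.exp (2 * β * ∑ k, |x k|) :=
          Finset.prod_le_prod
            (fun i _ => Finset.prod_nonneg fun j _ => Real.rpow_nonneg (abs_nonneg _) _)
            (fun i _ => Finset.prod_le_prod (fun j _ => Real.rpow_nonneg (abs_nonneg _) _)
              (fun j _ => h3 i j))
      _ = Real.exp (C * ∑ k, |x k|) := by
          simp only [← Real.exp_sum, Finset.sum_const, nsmul_eq_mul]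
          rw [← Finset.sum_mul, hC]
          ring_nf
  unfold gaussianBetaWeight
  refine (mul_le_mul_of_nonneg_left h4 (Real.exp_pos _).le).trans ?_
  simp only [← Real.exp_add, ← Real.exp_sum]
  rw [Real.exp_le_exp, Finset.mul_sum, Finset.mul_sum, ← Finset.sum_add_distrib]
  refine Finset.sum_le_sum fun i _ => ?_
  nlinarith [sq_nonneg (|x i| / 2 - C), sq_abs (x i)]

theorem partitionFunction_pos (n : ℕ) {β : ℝ} (hβ : 0 ≤ β) : 0 < partitionFunction n β := by
  refine integral_pos_of_integrable_nonneg_nonzero (continuous_gaussianBetaWeight n hβ)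
    (integrable_gaussianBetaWeight n hβ) (gaussianBetaWeight_nonneg n β)
    (x := fun i => (i : ℝ)) (ne_of_gt ?_)
  unfold gaussianBetaWeight
  refine mul_pos (Real.exp_pos _) (Finset.prod_pos fun i _ => Finset.prod_pos fun j hj => ?_)
  refine Real.rpow_pos_of_pos (abs_pos.mpr (sub_ne_zero.mpr ?_)) _
  have : i < j := Finset.mem_Ioi.mp hj
  have h' : (i : ℕ) < (j : ℕ) := this
  exact Nat.cast_injective.ne h'.ne'

open ProbabilityTheory Asymptotics
open scoped ENNReal NNReal Finset

/-!
Up to the factor `(2π)^(n/2)`, `Z_{n,β}` is the `β`-th moment `V(β)` of the absolute Vandermonde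
determinant of `n` independent standard Gaussians. Colouring the pair `{i, j}` by `i + j` in `ℤ/n`
splits the pairs into `n` classes, each consisting of disjoint pairs; within a class the
differences are independent, so Hölder's inequality over the classes gives
`V(β) ≤ (E|N(0, 2)|^(nβ))^((n - 1)/2)`. The same bound holds at `-β`, and `1 ≤ V(β) V(-β)` by
Cauchy–Schwarz turns it into a lower bound for `V(β)`. Since `log E|N(0, 2)|^s = -(γ/2) s + o(s)`
as `s → 0`, where `γ` is Euler's constant, the two bounds agree to first order when `nβ' → 0`, so
`log (Z_{n,β'} / Z_{n,β})` is equivalent to `-(γ/4) n² β'`. Both limits are read off from this.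
-/

section IndependentBlocks

variable {Ω ι J : Type*} {mΩ : MeasurableSpace Ω} {μ : Measure Ω}
  {m : ι → MeasurableSpace Ω} {S : J → Set ι} {f : J → Ω → ℝ≥0∞}

theorem lintegral_prod_eq_prod_lintegral_of_pairwiseDisjoint (hm : ∀ i, m i ≤ mΩ)
    (hindep : iIndep m μ) (hf : ∀ j, Measurable[⨆ i ∈ S j, m i] (f j)) {E : Finset J}
    (hE : (E : Set J).PairwiseDisjoint S) :
    ∫⁻ ω, ∏ j ∈ E, f j ω ∂μ = ∏ j ∈ E, ∫⁻ ω, f j ω ∂μ := by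
  have := hindep.isProbabilityMeasure
  induction E using Finset.cons_induction with
  | empty => simp
  | cons j E hj ih =>
    rw [Finset.coe_cons, Set.pairwiseDisjoint_insert_of_notMem (by simpa using hj)] at hE
    have hdisj : Disjoint (S j) (⋃ k ∈ E, S k) := Set.disjoint_iUnion₂_right.2 hE.2
    have hprod : Measurable[⨆ i ∈ ⋃ k ∈ E, S k, m i] fun ω => ∏ k ∈ E, f k ω :=
      Finset.measurable_fun_prod E fun k hk =>
        (hf k).mono (biSup_mono (Set.subset_biUnion_of_mem (u := S) hk)) le_rfl
    simp only [Finset.prod_cons]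
    rw [lintegral_mul_eq_lintegral_mul_lintegral_of_independent_measurableSpace
      (iSup₂_le fun i _ => hm i) (iSup₂_le fun i _ => hm i)
      (indep_iSup_of_disjoint hm hindep hdisj) (hf j) hprod, ih hE.1]

theorem lintegral_prod_le_prod_lintegral_rpow_of_coloring {κ : Type*} [Fintype κ] [Nonempty κ]
    (hm : ∀ i, m i ≤ mΩ) (hindep : iIndep m μ) (hf : ∀ j, Measurable[⨆ i ∈ S j, m i] (f j))
    (E : Finset J) (color : J → κ)
    (hcolor : ∀ c, {j ∈ (E : Set J) | color j = c}.PairwiseDisjoint S) :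
    ∫⁻ ω, ∏ j ∈ E, f j ω ∂μ ≤
      ∏ j ∈ E, (∫⁻ ω, f j ω ^ (Fintype.card κ : ℝ) ∂μ) ^ (Fintype.card κ : ℝ)⁻¹ := by
  classical
  set K := (Fintype.card κ : ℝ) with hKdef
  have hK : K ≠ 0 := Nat.cast_ne_zero.2 Fintype.card_ne_zero
  have hK' : 0 ≤ K⁻¹ := by positivity
  have hmeas : ∀ j, Measurable (f j) := fun j => (hf j).mono (iSup₂_le fun i _ => hm i) le_rfl
  calc ∫⁻ ω, ∏ j ∈ E, f j ω ∂μ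
      = ∫⁻ ω, ∏ c, (∏ j ∈ E with color j = c, f j ω ^ K) ^ K⁻¹ ∂μ := by
        simp only [← ENNReal.prod_rpow_of_nonneg hK', ENNReal.rpow_rpow_inv hK,
          Finset.prod_fiberwise E color fun j => f j _]
    _ ≤ ∏ c, (∫⁻ ω, ∏ j ∈ E with color j = c, f j ω ^ K ∂μ) ^ K⁻¹ :=
        ENNReal.lintegral_prod_norm_pow_le _ (fun c _ => by fun_prop)
          (by simp [hKdef]) (fun _ _ => hK')
    _ = ∏ c, ∏ j ∈ E with color j = c, (∫⁻ ω, f j ω ^ K ∂μ) ^ K⁻¹ := by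
        refine Finset.prod_congr rfl fun c _ => ?_
        rw [lintegral_prod_eq_prod_lintegral_of_pairwiseDisjoint hm hindep
          (fun j => (hf j).pow_const K) (by simpa using hcolor c),
          ENNReal.prod_rpow_of_nonneg hK']
    _ = ∏ j ∈ E, (∫⁻ ω, f j ω ^ K ∂μ) ^ K⁻¹ := Finset.prod_fiberwise E color _

end IndependentBlocks

theorem one_le_lintegral_mul_lintegral_inv {Ω : Type*} {mΩ : MeasurableSpace Ω} {μ : Measure Ω}
    [IsProbabilityMeasure μ] {f : Ω → ℝ≥0∞} (hf : AEMeasurable f μ) (hfin : ∫⁻ ω, f ω ∂μ ≠ ∞)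
    (hfin' : ∫⁻ ω, (f ω)⁻¹ ∂μ ≠ ∞) : 1 ≤ (∫⁻ ω, f ω ∂μ) * ∫⁻ ω, (f ω)⁻¹ ∂μ := by
  have hone : (fun ω => f ω ^ (1 / 2 : ℝ)) * (fun ω => f⁻¹ ω ^ (1 / 2 : ℝ)) =ᵐ[μ] fun _ => 1 := by
    filter_upwards [ae_lt_top' hf hfin, ae_lt_top' hf.inv hfin'] with ω htop hinv
    rw [Pi.mul_apply, Pi.inv_apply, ← ENNReal.mul_rpow_of_nonneg _ _ (by norm_num),
      ENNReal.mul_inv_cancel (ENNReal.inv_lt_top.1 hinv).ne' htop.ne, ENNReal.one_rpow]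
  have hsq : ∀ a : ℝ≥0∞, (a ^ (1 / 2 : ℝ)) ^ (2 : ℝ) = a := fun a => by
    rw [← ENNReal.rpow_mul]; norm_num
  have hCS := ENNReal.lintegral_mul_le_Lp_mul_Lq μ Real.HolderConjugate.two_two
    (hf.pow_const (1 / 2 : ℝ)) (hf.inv.pow_const (1 / 2 : ℝ))
  rw [lintegral_congr_ae hone, lintegral_one, measure_univ,
    ← ENNReal.mul_rpow_of_nonneg _ _ (by norm_num)] at hCS
  simpa only [ENNReal.one_rpow, hsq, Pi.inv_apply] using
    ENNReal.rpow_le_rpow hCS (zero_le_two (α := ℝ))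

theorem pi_withDensity_ofReal {ι : Type*} [Fintype ι] {α : ι → Type*}
    [∀ i, MeasurableSpace (α i)] {ν : ∀ i, Measure (α i)} [∀ i, SigmaFinite (ν i)]
    {f : ∀ i, α i → ℝ} (hf0 : ∀ i t, 0 ≤ f i t) (hf : ∀ i, Integrable (f i) (ν i)) :
    Measure.pi (fun i => (ν i).withDensity fun t => ENNReal.ofReal (f i t)) =
      (Measure.pi ν).withDensity fun x => ENNReal.ofReal (∏ i, f i (x i)) := by
  have : ∀ i, IsFiniteMeasure ((ν i).withDensity fun t => ENNReal.ofReal (f i t)) := fun i =>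
    isFiniteMeasure_withDensity_ofReal (hf i).2
  refine Measure.pi_eq fun s hs => ?_
  rw [withDensity_apply _ (MeasurableSet.univ_pi hs), Measure.restrict_pi_pi,
    ← ofReal_integral_eq_lintegral_ofReal (Integrable.fintype_prod_dep fun i => (hf i).restrict)
      (Eventually.of_forall fun x => Finset.prod_nonneg fun i _ => hf0 i _),
    integral_fintype_prod_eq_prod f,
    ENNReal.ofReal_prod_of_nonneg fun i _ => integral_nonneg (hf0 i)]
  refine Finset.prod_congr rfl fun i _ => ?_
  rw [withDensity_apply _ (hs i), ofReal_integral_eq_lintegral_ofReal (hf i).restrict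
    (Eventually.of_forall (hf0 i))]

theorem map_pi_prodMk {ι : Type*} [Fintype ι] {α : ι → Type*} [∀ i, MeasurableSpace (α i)]
    {ν : ∀ i, Measure (α i)} [∀ i, IsProbabilityMeasure (ν i)] {i j : ι} (hij : i ≠ j) :
    (Measure.pi ν).map (fun x => (x i, x j)) = (ν i).prod (ν j) := by
  have hindep : iIndepFun (fun i (x : ∀ i, α i) => x i) (Measure.pi ν) :=
    iIndepFun_pi (X := fun _ => id) fun _ => aemeasurable_id
  rw [(indepFun_iff_map_prod_eq_prod_map_map (measurable_pi_apply i).aemeasurable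
    (measurable_pi_apply j).aemeasurable).1 (hindep.indepFun hij),
    (measurePreserving_eval ν i).map_eq, (measurePreserving_eval ν j).map_eq]

theorem lintegral_pi_prod_pair_le_of_coloring {ι α κ : Type*} [Fintype ι] [MeasurableSpace α]
    [Fintype κ] [Nonempty κ] {ν : Measure α} [IsProbabilityMeasure ν] {g : α × α → ℝ≥0∞}
    (hg : Measurable g) (E : Finset (ι × ι)) (hE : ∀ p ∈ E, p.1 ≠ p.2) (color : ι × ι → κ)
    (hcolor : ∀ c, {p ∈ (E : Set (ι × ι)) | color p = c}.PairwiseDisjoint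
      fun p => ({p.1, p.2} : Set ι)) :
    ∫⁻ x, ∏ p ∈ E, g (x p.1, x p.2) ∂Measure.pi (fun _ => ν) ≤
      (∫⁻ z, g z ^ (Fintype.card κ : ℝ) ∂ν.prod ν) ^ (#E / Fintype.card κ : ℝ) := by
  let m (i : ι) : MeasurableSpace (ι → α) := .comap (fun x => x i) inferInstance
  have hindep : iIndep m (Measure.pi fun _ => ν) :=
    iIndepFun_pi (X := fun _ => id) fun _ => aemeasurable_id
  have heval {S : Set ι} {i : ι} (hi : i ∈ S) : Measurable[⨆ i ∈ S, m i] fun x : ι → α => x i :=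
    (comap_measurable _).mono (le_iSup₂_of_le i hi le_rfl) le_rfl
  have hpair (p : ι × ι) (hp : p ∈ E) :
      ∫⁻ x, g (x p.1, x p.2) ^ (Fintype.card κ : ℝ) ∂Measure.pi (fun _ => ν) =
        ∫⁻ z, g z ^ (Fintype.card κ : ℝ) ∂ν.prod ν := by
    rw [← map_pi_prodMk (ν := fun _ => ν) (hE p hp), lintegral_map (by fun_prop) (by fun_prop)]
  calc ∫⁻ x, ∏ p ∈ E, g (x p.1, x p.2) ∂Measure.pi (fun _ => ν)
      ≤ ∏ p ∈ E, (∫⁻ x, g (x p.1, x p.2) ^ (Fintype.card κ : ℝ) ∂Measure.pi fun _ => ν) ^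
          (Fintype.card κ : ℝ)⁻¹ :=
        lintegral_prod_le_prod_lintegral_rpow_of_coloring
          (fun i => (measurable_pi_apply i).comap_le) hindep
          (fun p => hg.comp ((heval (by simp)).prodMk (heval (by simp)))) E color hcolor
    _ = (∫⁻ z, g z ^ (Fintype.card κ : ℝ) ∂ν.prod ν) ^ (#E / Fintype.card κ : ℝ) := by
        rw [Finset.prod_congr rfl fun p hp => by rw [hpair p hp], Finset.prod_const,
          ← ENNReal.rpow_natCast, ← ENNReal.rpow_mul, div_eq_inv_mul]

theorem enorm_det_vandermonde {𝕜 : Type*} [NormedField 𝕜] {n : ℕ} (x : Fin n → 𝕜) :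
    ‖(Matrix.vandermonde x).det‖ₑ =
      ∏ p : Fin n × Fin n with p.1 < p.2, ‖x p.2 - x p.1‖ₑ := by
  rw [Finset.prod_finset_product _ Finset.univ (fun i => Finset.Ioi i) (by simp),
    Matrix.det_vandermonde]
  simp only [enorm_eq_nnnorm, nnnorm_prod]
  push_cast
  rfl

theorem disjoint_pair_of_add_eq_add {G : Type*} [AddCancelCommMonoid G] [Preorder G] {p q : G × G}
    (hp : p.1 < p.2) (hq : q.1 < q.2) (hpq : p ≠ q) (hadd : p.1 + p.2 = q.1 + q.2) :
    Disjoint ({p.1, p.2} : Set G) {q.1, q.2} := by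
  obtain ⟨i, j⟩ := p
  obtain ⟨k, l⟩ := q
  dsimp only at hp hq hadd
  rw [Set.disjoint_left]
  rintro x (rfl | rfl) (rfl | rfl)
  · exact hpq (congrArg _ (add_left_cancel hadd))
  · rw [add_comm k, add_right_inj] at hadd
    exact (hp.trans (hadd ▸ hq)).false
  · rw [add_comm i, add_right_inj] at hadd
    exact (hq.trans (hadd ▸ hp)).false
  · exact hpq (congrArg (·, x) (add_right_cancel hadd))

section VandermondeMoment

variable {𝕜 : Type*} [NormedField 𝕜] [MeasurableSpace 𝕜]

/-- The `b`-th moment of the absolute value of the Vandermonde determinant of `n` independent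
variables of law `ν`. It takes values in `ℝ≥0∞`, so that for `b < 0` the integrand is `∞`, rather
than the real-power value `0`, on the set where two of the variables coincide. -/
noncomputable def vandermondeMoment (ν : Measure 𝕜) (n : ℕ) (b : ℝ) : ℝ≥0∞ :=
  ∫⁻ x, ‖(Matrix.vandermonde x).det‖ₑ ^ b ∂Measure.pi fun _ : Fin n => ν

variable [OpensMeasurableSpace 𝕜] [MeasurableSub₂ 𝕜] {ν : Measure 𝕜} [IsProbabilityMeasure ν]

theorem measurable_enorm_det_vandermonde (n : ℕ) :
    Measurable fun x : Fin n → 𝕜 => ‖(Matrix.vandermonde x).det‖ₑ := by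
  simp only [enorm_det_vandermonde]
  fun_prop

theorem vandermondeMoment_le (n : ℕ) [NeZero n] (b : ℝ) :
    vandermondeMoment ν n b ≤
      (∫⁻ z, ‖z.2 - z.1‖ₑ ^ (n * b) ∂ν.prod ν) ^ (((n : ℝ) - 1) / 2) := by
  have hn : (n : ℝ) ≠ 0 := NeZero.ne _
  have hcard : (#{p : Fin n × Fin n | p.1 < p.2} : ℝ) / n = (n - 1) / 2 := by
    rw [Fintype.card_product_filter_lt, Fintype.card_fin, Nat.cast_choose_two]
    field_simp
  simp only [vandermondeMoment, enorm_det_vandermonde,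
    ← ENNReal.prod_rpow_of_ne_top fun _ _ => enorm_ne_top]
  refine (lintegral_pi_prod_pair_le_of_coloring (ν := ν) (g := fun z => ‖z.2 - z.1‖ₑ ^ b)
    (by fun_prop) _ (fun p hp => ne_of_lt (by simpa using hp)) (fun p => p.1 + p.2)
    fun c p hp q hq hpq => disjoint_pair_of_add_eq_add (by simpa using hp.1) (by simpa using hq.1)
      hpq (hp.2.trans hq.2.symm)).trans_eq ?_
  simp only [Fintype.card_fin, hcard, ← ENNReal.rpow_mul, mul_comm b]

theorem one_le_vandermondeMoment_mul_neg {n : ℕ} {b : ℝ} (hb : vandermondeMoment ν n b ≠ ∞)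
    (hb' : vandermondeMoment ν n (-b) ≠ ∞) :
    1 ≤ vandermondeMoment ν n b * vandermondeMoment ν n (-b) := by
  simp only [vandermondeMoment, ENNReal.rpow_neg] at hb hb' ⊢
  exact one_le_lintegral_mul_lintegral_inv
    ((measurable_enorm_det_vandermonde n).pow_const b).aemeasurable hb hb'

end VandermondeMoment

theorem map_sub_prod_gaussianReal (m₁ m₂ : ℝ) (v₁ v₂ : ℝ≥0) :
    ((gaussianReal m₁ v₁).prod (gaussianReal m₂ v₂)).map (fun z => z.2 - z.1) =
      gaussianReal (m₂ - m₁) (v₁ + v₂) := by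
  rw [sub_eq_neg_add, ← gaussianReal_conv_gaussianReal, ← gaussianReal_map_neg, Measure.conv,
    ← Measure.map_id (μ := gaussianReal m₂ v₂),
    Measure.map_prod_map _ _ (by fun_prop) (by fun_prop),
    Measure.map_map (by fun_prop) (by fun_prop), Measure.map_id]
  simp only [Function.comp_def, Prod.map, id, sub_eq_neg_add]

/-- The logarithm of the `s`-th absolute moment of a centered Gaussian of variance `v`, in closed
form. Meaningful for `v ≠ 0` and `-1 < s`; for `s ≤ -1` the moment is infinite. -/
noncomputable def logGaussianAbsMoment (v : ℝ≥0) (s : ℝ) : ℝ :=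
  s / 2 * Real.log (2 * v) + Real.log (Real.Gamma ((s + 1) / 2)) - Real.log √Real.pi

theorem logGaussianAbsMoment_zero (v : ℝ≥0) : logGaussianAbsMoment v 0 = 0 := by
  simp [logGaussianAbsMoment, Real.Gamma_one_half_eq, -one_div]

theorem hasDerivAt_logGaussianAbsMoment_zero {v : ℝ≥0} (hv : v ≠ 0) :
    HasDerivAt (logGaussianAbsMoment v)
      ((Real.log (v / 2) - Real.eulerMascheroniConstant) / 2) 0 := by
  have hhalf : HasDerivAt (fun s : ℝ => (s + 1) / 2) (1 / 2) 0 :=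
    ((hasDerivAt_id (0 : ℝ)).add_const 1).div_const 2
  have hGamma : HasDerivAt (fun s : ℝ => Real.Gamma ((s + 1) / 2))
      (-√Real.pi * (Real.eulerMascheroniConstant + 2 * Real.log 2) * (1 / 2)) 0 :=
    HasDerivAt.comp (0 : ℝ) (h₂ := Real.Gamma)
      (by simpa using Real.hasDerivAt_Gamma_one_half) hhalf
  have hlog := hGamma.log (by rw [zero_add, Real.Gamma_one_half_eq]; positivity)
  refine ((((hasDerivAt_id (0 : ℝ)).div_const 2).mul_const (Real.log (2 * v))).add
    hlog).sub_const (Real.log √Real.pi) |>.congr_deriv ?_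
  rw [zero_add, Real.Gamma_one_half_eq, Real.log_mul two_ne_zero (by positivity),
    Real.log_div (by positivity) two_ne_zero]
  field_simp
  ring

theorem integral_rpow_abs_mul_gaussianPDFReal {v : ℝ≥0} (hv : v ≠ 0) {s : ℝ} (hs : -1 < s) :
    ∫ t, |t| ^ s * gaussianPDFReal 0 v t = Real.exp (logGaussianAbsMoment v s) := by
  have hpdf (t : ℝ) : |t| ^ s * gaussianPDFReal 0 v t =
      (√(2 * Real.pi * v))⁻¹ * (|t| ^ s * Real.exp (-(2 * v : ℝ)⁻¹ * |t| ^ (2 : ℝ))) := by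
    rw [gaussianPDFReal, Real.rpow_two, sq_abs]
    ring_nf
  have hsqrt : √(2 * Real.pi * v) = √(2 * v) * √Real.pi := by
    rw [← Real.sqrt_mul (by positivity), mul_right_comm]
  have hpow : (2 * v : ℝ)⁻¹ ^ (-(s + 1) / 2) =
      Real.exp (s / 2 * Real.log (2 * v)) * √(2 * v) := by
    rw [Real.inv_rpow (by positivity), ← Real.rpow_neg (by positivity), Real.sqrt_eq_rpow,
      mul_comm (s / 2), ← Real.rpow_def_of_pos (by positivity), ← Real.rpow_add (by positivity)]
    ring_nf
  have hΓ := Real.Gamma_pos_of_pos (show 0 < (s + 1) / 2 by linarith)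
  simp only [hpdf, integral_const_mul]
  rw [integral_comp_abs (f := fun t => t ^ s * Real.exp (-(2 * v : ℝ)⁻¹ * t ^ (2 : ℝ))),
    integral_rpow_mul_exp_neg_mul_rpow two_pos hs (by positivity), logGaussianAbsMoment,
    Real.exp_sub, Real.exp_add, Real.exp_log hΓ, Real.exp_log (by positivity), hpow, hsqrt]
  field_simp

theorem lintegral_enorm_rpow_gaussianReal {v : ℝ≥0} (hv : v ≠ 0) {s : ℝ} (hs : -1 < s) :
    ∫⁻ t, ‖t‖ₑ ^ s ∂gaussianReal 0 v = ENNReal.ofReal (Real.exp (logGaussianAbsMoment v s)) := by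
  have : NullSingletonClass (gaussianReal 0 v) := nullSingletonClass_gaussianReal hv
  have hmoment := integral_rpow_abs_mul_gaussianPDFReal hv hs
  have hint : Integrable fun t => |t| ^ s * gaussianPDFReal 0 v t :=
    not_imp_comm.1 integral_undef (hmoment ▸ (Real.exp_pos _).ne')
  rw [← hmoment, ofReal_integral_eq_lintegral_ofReal hint
      (Eventually.of_forall fun t => mul_nonneg (by positivity) (gaussianPDFReal_nonneg _ _ _)),
    gaussianReal_of_var_ne_zero _ hv, lintegral_withDensity_eq_lintegral_mul _
      (measurable_gaussianPDF _ _) (by fun_prop)]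
  refine lintegral_congr_ae ?_
  filter_upwards [Measure.ae_ne volume 0] with t ht
  rw [Pi.mul_apply, gaussianPDF, Real.enorm_eq_ofReal_abs,
    ENNReal.ofReal_rpow_of_pos (abs_pos.2 ht), ENNReal.ofReal_mul (by positivity), mul_comm]

section GaussianVandermonde

variable {m : ℝ} {v : ℝ≥0} {n : ℕ} [NeZero n] {b : ℝ}

theorem vandermondeMoment_gaussianReal_le (hv : v ≠ 0) (hb : -1 < n * b) :
    vandermondeMoment (gaussianReal m v) n b ≤
      ENNReal.ofReal (Real.exp ((n - 1) / 2 * logGaussianAbsMoment (v + v) (n * b))) := by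
  refine (vandermondeMoment_le n b).trans_eq ?_
  rw [← lintegral_map (f := fun t => ‖t‖ₑ ^ (n * b)) (g := fun z : ℝ × ℝ => z.2 - z.1)
      (by fun_prop) (by fun_prop), map_sub_prod_gaussianReal, sub_self,
    lintegral_enorm_rpow_gaussianReal (by simpa using hv) hb,
    ENNReal.ofReal_rpow_of_pos (Real.exp_pos _), ← Real.exp_mul, mul_comm]

theorem log_vandermondeMoment_gaussianReal_mem_Icc (hv : v ≠ 0) (hb : |n * b| < 1) :
    Real.log (vandermondeMoment (gaussianReal m v) n b).toReal ∈
      Set.Icc (-((n - 1) / 2 * logGaussianAbsMoment (v + v) (-(n * b))))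
        ((n - 1) / 2 * logGaussianAbsMoment (v + v) (n * b)) := by
  have hle := vandermondeMoment_gaussianReal_le (m := m) hv (abs_lt.1 hb).1
  have hle' := vandermondeMoment_gaussianReal_le (m := m) (n := n) (b := -b) hv
    (by linarith [(abs_lt.1 hb).2])
  have hfin := ne_top_of_le_ne_top ENNReal.ofReal_ne_top hle
  have hfin' := ne_top_of_le_ne_top ENNReal.ofReal_ne_top hle'
  have hmul := ENNReal.toReal_mono (ENNReal.mul_ne_top hfin hfin')
    (one_le_vandermondeMoment_mul_neg hfin hfin')
  rw [ENNReal.toReal_one, ENNReal.toReal_mul] at hmul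
  have hpos := pos_of_mul_pos_left (one_pos.trans_le hmul) ENNReal.toReal_nonneg
  have hpos' := pos_of_mul_pos_right (one_pos.trans_le hmul) ENNReal.toReal_nonneg
  have hlog := Real.log_nonneg hmul
  rw [Real.log_mul hpos.ne' hpos'.ne'] at hlog
  have hlog_le := (Real.log_le_iff_le_exp hpos).2
    (ENNReal.toReal_le_of_le_ofReal (Real.exp_pos _).le hle)
  have hlog_le' := (Real.log_le_iff_le_exp hpos').2
    (ENNReal.toReal_le_of_le_ofReal (Real.exp_pos _).le hle')
  rw [mul_neg] at hlog_le'
  exact ⟨by linarith, hlog_le⟩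

end GaussianVandermonde

theorem isLittleO_sub_one_mul_sub_of_hasDerivAt {f : ℝ → ℝ} {d : ℝ} (hf : HasDerivAt f d 0)
    (hf0 : f 0 = 0) {t : ℕ → ℝ} (ht : Tendsto t atTop (𝓝 0)) :
    (fun n : ℕ => ((n : ℝ) - 1) * f (t n) - d * (n * t n)) =o[atTop] fun n => n * t n := by
  have hremainder : (fun n => f (t n) - d * t n) =o[atTop] t := by
    simpa [hf0, mul_comm d, Function.comp_def] using
      (hasDerivAt_iff_isLittleO.1 hf).comp_tendsto ht
  have hone : (fun _ : ℕ => (1 : ℝ)) =o[atTop] fun n : ℕ => (n : ℝ) :=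
    isLittleO_const_id_atTop 1 |>.comp_tendsto tendsto_natCast_atTop_atTop
  have hsub : (fun n : ℕ => (n : ℝ) - 1) =O[atTop] fun n => (n : ℝ) :=
    (isBigO_refl _ _).sub hone.isBigO
  refine ((hsub.mul_isLittleO hremainder).sub
    ((hone.mul_isBigO (isBigO_refl t _)).const_mul_left d)).congr_left fun n => ?_
  ring

theorem log_vandermondeMoment_gaussianReal_sub_isLittleO {m : ℝ} {v : ℝ≥0} (hv : v ≠ 0)
    {β : ℕ → ℝ} (hβ : Tendsto (fun n : ℕ => n * β n) atTop (𝓝 0)) :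
    (fun n => Real.log (vandermondeMoment (gaussianReal m v) n (β n)).toReal -
        (Real.log v - Real.eulerMascheroniConstant) / 4 * (n ^ 2 * β n))
      =o[atTop] fun n : ℕ => (n : ℝ) ^ 2 * β n := by
  have hderiv := hasDerivAt_logGaussianAbsMoment_zero (v := v + v) (by simpa using hv)
  rw [NNReal.coe_add, add_self_div_two] at hderiv
  have hexpand {t : ℕ → ℝ} (ht : Tendsto t atTop (𝓝 0)) :=
    isLittleO_sub_one_mul_sub_of_hasDerivAt hderiv (logGaussianAbsMoment_zero _) ht
  have hupper := hexpand hβ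
  have hlower := hexpand (neg_zero (G := ℝ) ▸ hβ.neg)
  simp only [mul_neg, isLittleO_neg_right] at hlower
  refine (IsBigO.of_bound' ?_).trans_isLittleO
    ((hupper.norm_left.add hlower.norm_left).congr_right fun n => by ring)
  filter_upwards [eventually_ne_atTop 0,
    hβ.abs.eventually_lt_const (by simp : |(0 : ℝ)| < 1)] with n hn hnβ
  have : NeZero n := ⟨hn⟩
  obtain ⟨hge, hle⟩ := log_vandermondeMoment_gaussianReal_mem_Icc (m := m) hv hnβ
  have habs (x y z : ℝ) (hxy : -y / 2 ≤ x) (hxz : x ≤ z / 2) : |x| ≤ |z| + |y| := by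
    rw [abs_le]
    constructor <;> linarith [le_abs_self y, le_abs_self z, abs_nonneg y, abs_nonneg z]
  rw [Real.norm_of_nonneg (add_nonneg (norm_nonneg _) (norm_nonneg _))]
  exact habs _ _ _ (by linarith) (by linarith)

theorem gaussianBetaWeight_eq_mul_det_vandermonde (n : ℕ) (β : ℝ) (x : Fin n → ℝ) :
    gaussianBetaWeight n β x = √(2 * Real.pi) ^ n *
      ((∏ i, gaussianPDFReal 0 1 (x i)) * |(Matrix.vandermonde x).det| ^ β) := by
  have hpdf : ∏ i, gaussianPDFReal 0 1 (x i) =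
      (√(2 * Real.pi) ^ n)⁻¹ * Real.exp (-(1 / 2) * ∑ i, x i ^ 2) := by
    simp only [gaussianPDFReal, Finset.prod_mul_distrib, ← Real.exp_sum, Finset.mul_sum,
      Finset.prod_const, Finset.card_univ, Fintype.card_fin, NNReal.coe_one, mul_one, sub_zero,
      inv_pow]
    congr! 3
    ring
  have hdet : |(Matrix.vandermonde x).det| ^ β =
      ∏ i : Fin n, ∏ j ∈ Finset.Ioi i, |x j - x i| ^ β := by
    simp only [Matrix.det_vandermonde, Finset.abs_prod, Real.finsetProd_rpow, abs_nonneg,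
      Finset.prod_nonneg, implies_true]
  rw [hpdf, hdet, gaussianBetaWeight]
  field_simp

theorem partitionFunction_eq_mul_vandermondeMoment (n : ℕ) {β : ℝ} (hβ : 0 ≤ β) :
    partitionFunction n β =
      √(2 * Real.pi) ^ n * (vandermondeMoment (gaussianReal 0 1) n β).toReal := by
  have hdensity : Measure.pi (fun _ : Fin n => gaussianReal 0 1) =
      volume.withDensity fun x => ENNReal.ofReal (∏ i, gaussianPDFReal 0 1 (x i)) := by
    rw [gaussianReal_of_var_ne_zero _ one_ne_zero]
    exact pi_withDensity_ofReal (fun _ => gaussianPDFReal_nonneg 0 1)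
      fun _ => integrable_gaussianPDFReal 0 1
  have hweight (x : Fin n → ℝ) : ENNReal.ofReal (gaussianBetaWeight n β x) =
      ENNReal.ofReal (√(2 * Real.pi) ^ n) * (ENNReal.ofReal (∏ i, gaussianPDFReal 0 1 (x i)) *
        ‖(Matrix.vandermonde x).det‖ₑ ^ β) := by
    rw [gaussianBetaWeight_eq_mul_det_vandermonde, ENNReal.ofReal_mul (by positivity),
      ENNReal.ofReal_mul (Finset.prod_nonneg fun i _ => gaussianPDFReal_nonneg 0 1 _),
      Real.enorm_eq_ofReal_abs, ENNReal.ofReal_rpow_of_nonneg (abs_nonneg _) hβ]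
  rw [partitionFunction, vandermondeMoment, hdensity,
    lintegral_withDensity_eq_lintegral_mul _ (by fun_prop)
      ((measurable_enorm_det_vandermonde n).pow_const β),
    integral_eq_lintegral_of_nonneg_ae (.of_forall (gaussianBetaWeight_nonneg n β))
      (continuous_gaussianBetaWeight n hβ).aestronglyMeasurable]
  simp only [hweight, lintegral_const_mul' _ _ ENNReal.ofReal_ne_top, ENNReal.toReal_mul,
    ENNReal.toReal_ofReal (pow_nonneg (Real.sqrt_nonneg _) n), Pi.mul_apply]

theorem log_partitionFunction_div_isEquivalent {β β' : ℕ → ℝ} (hβ : ∀ n, 0 ≤ β n)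
    (hβ' : ∀ n, 0 ≤ β' n) (hββ' : β =o[atTop] β')
    (hsmall : Tendsto (fun n : ℕ => n * β' n) atTop (𝓝 0)) :
    (fun n => Real.log (partitionFunction n (β' n) / partitionFunction n (β n))) ~[atTop]
      fun n : ℕ => -(Real.eulerMascheroniConstant / 4) * ((n : ℝ) ^ 2 * β' n) := by
  have hlin : (fun n : ℕ => n * β n) =o[atTop] fun n => n * β' n :=
    (isBigO_refl (fun n : ℕ => (n : ℝ)) _).mul_isLittleO hββ'
  have hsq : (fun n : ℕ => (n : ℝ) ^ 2 * β n) =o[atTop] fun n => (n : ℝ) ^ 2 * β' n :=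
    (isBigO_refl (fun n : ℕ => (n : ℝ) ^ 2) _).mul_isLittleO hββ'
  have hlog := log_vandermondeMoment_gaussianReal_sub_isLittleO (m := 0) one_ne_zero
    (hlin.isBigO.trans_tendsto hsmall)
  have hlog' := log_vandermondeMoment_gaussianReal_sub_isLittleO (m := 0) one_ne_zero hsmall
  simp only [NNReal.coe_one, Real.log_one, zero_sub, neg_div] at hlog hlog'
  have hmoment {n : ℕ} {b : ℝ} (hb : 0 ≤ b) :
      (vandermondeMoment (gaussianReal 0 1) n b).toReal ≠ 0 := fun h => by
    simpa [partitionFunction_eq_mul_vandermondeMoment n hb, h] using partitionFunction_pos n hb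
  have hratio (n : ℕ) : Real.log (partitionFunction n (β' n) / partitionFunction n (β n)) =
      Real.log (vandermondeMoment (gaussianReal 0 1) n (β' n)).toReal -
        Real.log (vandermondeMoment (gaussianReal 0 1) n (β n)).toReal := by
    rw [partitionFunction_eq_mul_vandermondeMoment n (hβ n),
      partitionFunction_eq_mul_vandermondeMoment n (hβ' n),
      mul_div_mul_left _ _ (by positivity), Real.log_div (hmoment (hβ' n)) (hmoment (hβ n))]
  have hγ : -(Real.eulerMascheroniConstant / 4) ≠ 0 := by
    linarith [Real.one_half_lt_eulerMascheroniConstant]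
  refine (((hlog'.sub (hlog.trans hsq)).sub (hsq.const_mul_left
    (-(Real.eulerMascheroniConstant / 4)))).const_mul_right hγ).congr_left fun n => ?_
  rw [Pi.sub_apply, hratio]
  ring

theorem MuchLess.isLittleO {u v : ℕ → ℝ} (h : MuchLess u v) (hv : ∀ n, v n ≠ 0) :
    u =o[atTop] v :=
  isLittleO_of_tendsto (fun n hn => absurd hn (hv n)) h

theorem MuchLess.tendsto_mul_nhds_zero {u v : ℕ → ℝ} (h : MuchLess u fun n => 1 / v n) :
    Tendsto (fun n => v n * u n) atTop (𝓝 0) :=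
  h.congr fun n => by rw [div_div_eq_mul_div, div_one, mul_comm]

theorem MuchLess.tendsto_mul_atTop {u v : ℕ → ℝ} (h : MuchLess (fun n => 1 / v n) u)
    (hpos : ∀ᶠ n in atTop, 0 < v n * u n) : Tendsto (fun n => v n * u n) atTop atTop := by
  have hinv : Tendsto (fun n => (v n * u n)⁻¹) atTop (𝓝[>] 0) :=
    tendsto_nhdsWithin_iff.2
      ⟨h.congr fun n => by rw [div_div, one_div], hpos.mono fun n hn => inv_pos.2 hn⟩
  simpa only [Pi.inv_def, inv_inv] using hinv.inv_tendsto_nhdsGT_zero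

theorem mainTheorem2 (β β' : ℕ → ℝ) (hβ : ∀ n, 0 ≤ β n) (hβ' : ∀ n, 0 < β' n)
    (hββ' : MuchLess β β') :
    (MuchLess β' (fun n => 1 / (n : ℝ) ^ 2) →
      Tendsto (fun n => partitionFunction n (β' n) / partitionFunction n (β n)) atTop (𝓝 1)) ∧
    (MuchLess β' (fun n => 1 / (n : ℝ)) → MuchLess (fun n => 1 / (n : ℝ) ^ 2) β' →
      MuchLess (fun n => partitionFunction n (β' n)) (fun n => partitionFunction n (β n))) := by
  have hratio (n : ℕ) : 0 < partitionFunction n (β' n) / partitionFunction n (β n) :=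
    div_pos (partitionFunction_pos n (hβ' n).le) (partitionFunction_pos n (hβ n))
  have hlog := log_partitionFunction_div_isEquivalent hβ (fun n => (hβ' n).le)
    (hββ'.isLittleO fun n => (hβ' n).ne')
  have hγ : -(Real.eulerMascheroniConstant / 4) < 0 := by
    linarith [Real.one_half_lt_eulerMascheroniConstant]
  refine ⟨fun hsq => ?_, fun hlin hsq => ?_⟩
  · have hsq0 := hsq.tendsto_mul_nhds_zero
    have hlin0 : Tendsto (fun n : ℕ => n * β' n) atTop (𝓝 0) :=
      squeeze_zero (fun n => mul_nonneg n.cast_nonneg (hβ' n).le) (fun n =>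
        mul_le_mul_of_nonneg_right (mod_cast Nat.le_self_pow two_ne_zero n) (hβ' n).le) hsq0
    have hlog0 := (hlog hlin0).symm.tendsto_nhds (hsq0.const_mul _)
    simpa only [mul_zero, Real.exp_zero, Real.exp_log (hratio _)] using hlog0.rexp
  · have hsq_top := hsq.tendsto_mul_atTop ((eventually_gt_atTop 0).mono fun n hn =>
      mul_pos (pow_pos (Nat.cast_pos.2 hn) 2) (hβ' n))
    have hlog_bot := (hlog hlin.tendsto_mul_nhds_zero).symm.tendsto_atBot
      (hsq_top.const_mul_atTop_of_neg hγ)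
    simpa only [MuchLess, Function.comp_def, Real.exp_log (hratio _)] using
      Real.tendsto_exp_atBot.comp hlog_bot
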